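/- All graphs are finite, simple, undirected and loopless. A \emph{cograph} is a graph obtained from single vertices by repeatedly taking parallel compositions (disjoint unions) and series compositions (disjoint unions plus all edges between the two parts). For a graph $G=(V,E)$, write $N[x]=\{x\}\cup\{y : xy\in E\}$ for the closed neighbourhood of $x\in V$. The \emph{(closed) linearity} $\mathrm{lin}(G)$ is the least integer $p$ for which there are linear orders $\sigma_1,\dots,\sigma_p$ on $V$ such that for every $x\in V$ there are (possibly empty) sets $I_1,\dots,I_p$, with $I_i$ an interval of $\sigma_i$, satisfying $N[x]=\bigcup_{i=1}^p I_i$. \textbf{Theorem.} The linearity of a cograph on $n$ vertices is $O(\log n/\log\log n)$, and this bound is tight. That is, there are constants $C,c>0$ such that (1) for every $n\ge 3$, every cograph $G$ on $n$ vertices satisfies $\mathrm{lin}(G)\le C\,\dfrac{\log n}{\log\log n}$; (2) for every $n\ge 3$, there is a cograph $G$ on $n$ vertices with $\mathrm{lin}(G)\ge c\,\dfrac{\log n}{\log\log n}$. -/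

import Mathlib

universe u v

/-- The series composition of two graphs on disjoint vertex sets: their disjoint union, plus all
edges between a vertex of the first and a vertex of the second. -/
def seriesComp {V : Type u} {W : Type v} (G : SimpleGraph V) (H : SimpleGraph W) :
    SimpleGraph (V ⊕ W) :=
  (G ⊕g H) ⊔ completeBipartiteGraph V W

/-- Cographs: the graphs obtained from single vertices by parallel compositions (disjoint unions)
and series compositions, up to isomorphism. -/
inductive IsCograph : {V : Type u} → SimpleGraph V → Prop
  | single {V : Type u} [Unique V] (G : SimpleGraph V) : IsCograph G
  | parallel {V W : Type u} {G : SimpleGraph V} {H : SimpleGraph W} :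
      IsCograph G → IsCograph H → IsCograph (G ⊕g H)
  | series {V W : Type u} {G : SimpleGraph V} {H : SimpleGraph W} :
      IsCograph G → IsCograph H → IsCograph (seriesComp G H)
  | iso {V W : Type u} {G : SimpleGraph V} {H : SimpleGraph W} :
      IsCograph G → (G ≃g H) → IsCograph H

/-- The closed neighbourhood `N[x]`. -/
def closedNbhd {V : Type u} (G : SimpleGraph V) (x : V) : Set V := insert x (G.neighborSet x)

/-- `I` is an interval of the linear order `σ`: it contains everything that lies between two of
its elements. -/
def IsIntervalOf {V : Type u} (σ : LinearOrder V) (I : Set V) : Prop :=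
  @Set.OrdConnected V σ.toPartialOrder.toPreorder I

/-- `σ` is a closed `p`-line-model of `G`: each closed neighbourhood is the union of one interval
taken in each of the `p` linear orders. -/
def IsClosedLineModel {V : Type u} (G : SimpleGraph V) {p : ℕ} (σ : Fin p → LinearOrder V) :
    Prop :=
  ∀ x : V, ∃ I : Fin p → Set V, (∀ i, IsIntervalOf (σ i) (I i)) ∧ closedNbhd G x = ⋃ i, I i

/-- The closed linearity of `G`: the least `p` for which `G` has a closed `p`-line-model. -/
noncomputable def lin {V : Type u} (G : SimpleGraph V) : ℕ :=
  sInf {p : ℕ | ∃ σ : Fin p → LinearOrder V, IsClosedLineModel G σ}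

/-- Every finite graph has a closed line-model, so the minimum in `lin` is attained. -/
theorem exists_isClosedLineModel_lin {V : Type u} [Finite V] (G : SimpleGraph V) :
    ∃ σ : Fin (lin G) → LinearOrder V, IsClosedLineModel G σ := by
  obtain ⟨n, ⟨e⟩⟩ := Finite.exists_equiv_fin V
  refine Nat.sInf_mem (s := {p : ℕ | ∃ σ : Fin p → LinearOrder V, IsClosedLineModel G σ})
    ⟨n, fun _ => LinearOrder.lift' e e.injective, fun x => ?_⟩
  refine ⟨fun i => {y | y = e.symm i ∧ y ∈ closedNbhd G x}, fun i => ?_, ?_⟩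
  · refine @Set.OrdConnected.mk V (LinearOrder.lift' e e.injective).toPartialOrder.toPreorder _ ?_
    rintro a ⟨rfl, ha⟩ b ⟨rfl, -⟩ z ⟨h1, h2⟩
    have hz : z = e.symm i :=
      e.injective (le_antisymm (show e z ≤ e (e.symm i) from h2) (show e (e.symm i) ≤ e z from h1))
    exact ⟨hz, hz ▸ ha⟩
  · ext y
    simp only [Set.mem_iUnion, Set.mem_ofPred_eq]
    exact ⟨fun h => ⟨e y, by simp, h⟩, fun ⟨_, _, h⟩ => h⟩

/-! Upper bound: orders come in pairs, and `k` pairs serve every cograph with fewer than `(k + 1)!`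
vertices. In a series composition each neighbourhood must absorb the whole other part. A part with
fewer than `s = (k + 1)!` vertices uses only `k` of `k + 1` pairs, so the spare pair can carry the
other part. A larger part keeps an initial interval in some order, and the other part is placed
before it. Two large parts would want opposite directions, so they share out the pairs in proportion
to their sizes; `k + 1` pairs suffice below `(k + 2)!` vertices (`exists_initialCover_comp`,
`IsCograph.exists_model`).

Lower bound: join a universal vertex `y` to `2p + 1` copies of a graph. In `p` orders at most `2p`
copies come closest to `y` on some side, so for some copy no interval through `y` meets it without
meeting another copy. Covering a neighbourhood there costs one interval more than inside the copy
(`NeedsIntervals.series_copies`). Iterating `h` times takes at most `(2h + 2) ^ h` vertices and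
forces linearity at least `h + 1`. -/

/-! ### Intervals and concatenation of linear orders -/

lemma isIntervalOf_iff {V : Type u} {σ : LinearOrder V} {I : Set V} :
    IsIntervalOf σ I ↔ ∀ a ∈ I, ∀ b ∈ I, ∀ z, σ.le a z → σ.le z b → z ∈ I :=
  ⟨fun h _ ha _ hb _ h1 h2 => h.out' ha hb ⟨h1, h2⟩,
    fun h => @Set.OrdConnected.mk V σ.toPartialOrder.toPreorder _
      fun a ha b hb z hz => h a ha b hb z hz.1 hz.2⟩

lemma isIntervalOf_empty {V : Type u} (σ : LinearOrder V) : IsIntervalOf σ (∅ : Set V) := by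
  simp [isIntervalOf_iff]

lemma isIntervalOf_univ {V : Type u} (σ : LinearOrder V) : IsIntervalOf σ (Set.univ : Set V) := by
  simp [isIntervalOf_iff]

/-- `I` is an initial segment of `σ`. -/
def IsInitialOf {V : Type u} (σ : LinearOrder V) (I : Set V) : Prop :=
  ∀ a ∈ I, ∀ z, σ.le z a → z ∈ I

lemma IsInitialOf.isIntervalOf {V : Type u} {σ : LinearOrder V} {I : Set V}
    (h : IsInitialOf σ I) : IsIntervalOf σ I :=
  isIntervalOf_iff.2 fun _ _ b hb z _ hz => h b hb z hz

lemma IsIntervalOf.image {V : Type u} {U : Type v} {σ : LinearOrder V} {o : LinearOrder U}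
    {f : V → U} {I : Set V} (hI : IsIntervalOf σ I) (hf : ∀ a b, o.le (f a) (f b) ↔ σ.le a b)
    (hr : IsIntervalOf o (Set.range f)) : IsIntervalOf o (f '' I) := by
  rw [isIntervalOf_iff] at *
  rintro _ ⟨a, ha, rfl⟩ _ ⟨b, hb, rfl⟩ z h1 h2
  obtain ⟨c, rfl⟩ := hr _ ⟨a, rfl⟩ _ ⟨b, rfl⟩ z h1 h2
  exact ⟨c, hI a ha b hb c ((hf _ _).1 h1) ((hf _ _).1 h2), rfl⟩

lemma exists_linearOrder (V : Type u) : Nonempty (LinearOrder V) := by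
  classical
  exact ⟨IsWellOrder.linearOrder (WellOrderingRel (α := V))⟩

/-- Two linear orders can be concatenated with either of them coming first. -/
lemma exists_concat_order {V : Type u} {W : Type v} (σ : LinearOrder V) (τ : LinearOrder W)
    (Q : Prop) :
    ∃ o : LinearOrder (V ⊕ W),
      (∀ a b, o.le (Sum.inl a) (Sum.inl b) ↔ σ.le a b) ∧
      (∀ a b, o.le (Sum.inr a) (Sum.inr b) ↔ τ.le a b) ∧
      (Q → ∀ a b, o.le (Sum.inl a) (Sum.inr b)) ∧
      (¬ Q → ∀ a b, o.le (Sum.inr b) (Sum.inl a)) := by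
  by_cases hQ : Q
  · refine ⟨LinearOrder.lift' (β := V ⊕ₗ W) toLex toLex.injective, ?_, ?_, ?_, ?_⟩
    · exact fun a b => Sum.Lex.inl_le_inl_iff
    · exact fun a b => Sum.Lex.inr_le_inr_iff
    · exact fun _ a b => Sum.Lex.inl_le_inr a b
    · exact fun h => absurd hQ h
  · refine ⟨LinearOrder.lift' (β := W ⊕ₗ V) (fun x => toLex x.swap)
      (toLex.injective.comp Sum.swap_leftInverse.injective), ?_, ?_, ?_, ?_⟩
    · exact fun a b => Sum.Lex.inr_le_inr_iff
    · exact fun a b => Sum.Lex.inl_le_inl_iff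
    · exact fun h => absurd h hQ
    · exact fun _ a b => Sum.Lex.inl_le_inr b a

lemma closedNbhd_iso {V W : Type u} {G : SimpleGraph V} {H : SimpleGraph W} (e : G ≃g H) (x : V) :
    closedNbhd H (e x) = e '' closedNbhd G x := by
  ext y
  obtain ⟨y, rfl⟩ := e.surjective y
  simp [closedNbhd, e.map_adj_iff]

/-! ### Upper bound: covers under composition -/

/-- The condition that `U` is the disjoint union of two graphs along `f` and `g`, seen from the
side of `f`; all the edges between the two sides are present if `S` holds, and none otherwise. -/
structure IsSide {V W U : Type u} (G : SimpleGraph V) (K : SimpleGraph U) (f : V → U) (g : W → U)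
    (S : Prop) : Prop where
  compl : ∀ z, z ∈ Set.range f ↔ z ∉ Set.range g
  of_series : S → ∀ x, closedNbhd K (f x) = f '' closedNbhd G x ∪ Set.range g
  of_parallel : ¬ S → ∀ x, closedNbhd K (f x) = f '' closedNbhd G x

lemma isSide_inl_parallel {V W : Type u} (G : SimpleGraph V) (H : SimpleGraph W) :
    IsSide G (G ⊕g H) Sum.inl (Sum.inr : W → V ⊕ W) False where
  compl := by rintro (a | a) <;> simp
  of_series := by simp
  of_parallel _ x := by ext (a | a) <;> simp [closedNbhd]

lemma isSide_inr_parallel {V W : Type u} (G : SimpleGraph V) (H : SimpleGraph W) :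
    IsSide H (G ⊕g H) Sum.inr (Sum.inl : V → V ⊕ W) False where
  compl := by rintro (a | a) <;> simp
  of_series := by simp
  of_parallel _ x := by ext (a | a) <;> simp [closedNbhd]

lemma isSide_inl_series {V W : Type u} (G : SimpleGraph V) (H : SimpleGraph W) :
    IsSide G (seriesComp G H) Sum.inl (Sum.inr : W → V ⊕ W) True where
  compl := by rintro (a | a) <;> simp
  of_series _ x := by ext (a | a) <;> simp [closedNbhd, seriesComp]
  of_parallel := by simp

lemma isSide_inr_series {V W : Type u} (G : SimpleGraph V) (H : SimpleGraph W) :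
    IsSide H (seriesComp G H) Sum.inr (Sum.inl : V → V ⊕ W) True where
  compl := by rintro (a | a) <;> simp
  of_series _ x := by ext (a | a) <;> simp [closedNbhd, seriesComp]
  of_parallel := by simp

/-- `N[x]` is a union of intervals, the one in the first order of some pair in `P` being initial. -/
def HasInitialCover {V : Type u} (G : SimpleGraph V) {k : ℕ} (P : Finset (Fin k))
    (σ : Fin k × Bool → LinearOrder V) (x : V) : Prop :=
  ∃ t ∈ P, ∃ I : Fin k × Bool → Set V, (∀ i, IsIntervalOf (σ i) (I i)) ∧
    IsInitialOf (σ (t, false)) (I (t, false)) ∧ closedNbhd G x = ⋃ i, I i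

/-- `N[x]` is a union of intervals, the ones in the orders of the pair `t` being empty. -/
def HasCoverAvoiding {V : Type u} (G : SimpleGraph V) {k : ℕ} (t : Fin k)
    (σ : Fin k × Bool → LinearOrder V) (x : V) : Prop :=
  ∃ I : Fin k × Bool → Set V, (∀ i, IsIntervalOf (σ i) (I i)) ∧
    (∀ b, I (t, b) = ∅) ∧ closedNbhd G x = ⋃ i, I i

/-- The order `o` extends `σ` along `f` and the range of `f` is a block of `o`. -/
def IsBlock {V U : Type u} (σ : LinearOrder V) (o : LinearOrder U) (f : V → U) : Prop :=
  (∀ a b, o.le (f a) (f b) ↔ σ.le a b) ∧ IsIntervalOf o (Set.range f)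

/-- A block placed before an initial segment merges with it into an initial segment, so the series
case needs no new interval. In the parallel case the other part goes after, and the segment stays
initial. -/
lemma HasInitialCover.map {V W U : Type u} {G : SimpleGraph V} {K : SimpleGraph U} {f : V → U}
    {g : W → U} {S : Prop} (hS : IsSide G K f g S) {k : ℕ} {P P' : Finset (Fin k)} (hP : P ⊆ P')
    {σ : Fin k × Bool → LinearOrder V} {o : Fin k × Bool → LinearOrder U}
    (hf : ∀ i, IsBlock (σ i) (o i) f)
    (h1 : S → ∀ t ∈ P, ∀ a b, (o (t, false)).le (g b) (f a))
    (h2 : ¬ S → ∀ t ∈ P, ∀ a b, (o (t, false)).le (f a) (g b)) {x : V}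
    (hx : HasInitialCover G P σ x) : HasInitialCover K P' o (f x) := by
  classical
  obtain ⟨t, ht, I, hI, hinit, hN⟩ := hx
  have key : ∀ a b, f a ≠ g b := fun a b h => (hS.compl (f a)).1 ⟨a, rfl⟩ ⟨b, h.symm⟩
  have cov : ∀ z, z ∈ Set.range f ∨ z ∈ Set.range g := fun z => by
    rw [hS.compl]; exact (em _).symm
  by_cases s : S
  · have hini : IsInitialOf (o (t, false)) (f '' I (t, false) ∪ Set.range g) := by
      intro a ha z hz
      rcases cov z with ⟨z, rfl⟩ | h
      · rcases ha with ⟨a, ha, rfl⟩ | ⟨b, rfl⟩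
        · exact Or.inl ⟨z, hinit a ha z (((hf _).1 _ _).1 hz), rfl⟩
        · exact absurd ((o (t, false)).le_antisymm _ _ hz (h1 s t ht z b)) (key _ _)
      · exact Or.inr h
    refine ⟨t, hP ht, Function.update (fun i => f '' I i) (t, false)
      (f '' I (t, false) ∪ Set.range g), fun i => ?_, by simpa using hini, ?_⟩
    · by_cases hi : i = (t, false)
      · subst hi; simpa using hini.isIntervalOf
      · simpa [hi] using (hI i).image (hf i).1 (hf i).2
    · rw [hS.of_series s, hN]
      ext z
      simp only [Set.mem_union, Set.mem_iUnion, Set.image_iUnion]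
      constructor
      · rintro (⟨i, hi⟩ | h)
        · refine ⟨i, ?_⟩
          by_cases h : i = (t, false)
          · subst h; simpa using Or.inl hi
          · simpa [h] using hi
        · exact ⟨(t, false), by simpa using Or.inr h⟩
      · rintro ⟨i, hi⟩
        by_cases h : i = (t, false)
        · subst h
          rw [Function.update_self] at hi
          exact hi.imp_left fun h => ⟨_, h⟩
        · rw [Function.update_of_ne h] at hi
          exact Or.inl ⟨i, hi⟩
  · refine ⟨t, hP ht, fun i => f '' I i, fun i => (hI i).image (hf i).1 (hf i).2, ?_, ?_⟩
    · rintro _ ⟨a, ha, rfl⟩ z hz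
      rcases cov z with ⟨z, rfl⟩ | ⟨b, rfl⟩
      · exact ⟨z, hinit a ha z (((hf _).1 _ _).1 hz), rfl⟩
      · exact absurd ((o (t, false)).le_antisymm _ _ hz (h2 s t ht a b)).symm (key _ _)
    · rw [hS.of_parallel s, hN, Set.image_iUnion]

/-- This is why orders come in pairs: `(t, true)` can carry the whole other part, while `(t, false)`
stays empty, hence initial for later compositions. -/
lemma HasCoverAvoiding.map {V W U : Type u} {G : SimpleGraph V} {K : SimpleGraph U} {f : V → U}
    {g : W → U} {S : Prop} (hS : IsSide G K f g S) {k : ℕ} {t : Fin k} {P : Finset (Fin k)}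
    (ht : t ∈ P) {σ : Fin k × Bool → LinearOrder V} {o : Fin k × Bool → LinearOrder U}
    (hf : ∀ i, IsBlock (σ i) (o i) f) (hg : ∀ i, IsIntervalOf (o i) (Set.range g)) {x : V}
    (hx : HasCoverAvoiding G t σ x) : HasInitialCover K P o (f x) := by
  classical
  obtain ⟨I, hI, hempty, hN⟩ := hx
  have hb := fun i => (hI i).image (hf i).1 (hf i).2
  by_cases s : S
  · refine ⟨t, ht, Function.update (fun i => f '' I i) (t, true) (Set.range g), fun i => ?_, ?_, ?_⟩
    · by_cases hi : i = (t, true)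
      · subst hi; simpa using hg _
      · simpa [hi] using hb i
    · simp [hempty, IsInitialOf]
    · rw [hS.of_series s, hN]
      ext z
      simp only [Set.mem_union, Set.mem_iUnion, Set.image_iUnion]
      constructor
      · rintro (⟨i, hi⟩ | h)
        · refine ⟨i, ?_⟩
          by_cases h : i = (t, true)
          · subst h; simp [hempty] at hi
          · simpa [h] using hi
        · exact ⟨(t, true), by simpa using h⟩
      · rintro ⟨i, hi⟩
        by_cases h : i = (t, true)
        · subst h
          rw [Function.update_self] at hi
          exact Or.inr hi
        · rw [Function.update_of_ne h] at hi
          exact Or.inl ⟨i, hi⟩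
  · refine ⟨t, ht, fun i => f '' I i, hb, ?_, ?_⟩
    · simp [hempty, IsInitialOf]
    · rw [hS.of_parallel s, hN, Set.image_iUnion]

/-- Families of orders of the two parts can be concatenated with prescribed directions. -/
lemma exists_concat_orders {V W : Type u} {ι : Type*} (σ : ι → LinearOrder V)
    (τ : ι → LinearOrder W) (Q : ι → Prop) :
    ∃ o : ι → LinearOrder (V ⊕ W), (∀ i, IsBlock (σ i) (o i) Sum.inl) ∧
      (∀ i, IsBlock (τ i) (o i) Sum.inr) ∧
      (∀ i, Q i → ∀ a b, (o i).le (Sum.inl a) (Sum.inr b)) ∧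
      (∀ i, ¬ Q i → ∀ a b, (o i).le (Sum.inr b) (Sum.inl a)) := by
  choose o h1 h2 h3 h4 using fun i => exists_concat_order (σ i) (τ i) (Q i)
  refine ⟨o, fun i => ⟨h1 i, isIntervalOf_iff.2 ?_⟩, fun i => ⟨h2 i, isIntervalOf_iff.2 ?_⟩, h3, h4⟩
  · rintro _ ⟨a, rfl⟩ _ ⟨b, rfl⟩ (z | z) l1 l2
    · exact ⟨z, rfl⟩
    · by_cases q : Q i
      · cases (o i).le_antisymm _ _ l2 (h3 i q b z)
      · cases (o i).le_antisymm _ _ l1 (h4 i q a z)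
  · rintro _ ⟨a, rfl⟩ _ ⟨b, rfl⟩ (z | z) l1 l2
    · by_cases q : Q i
      · cases (o i).le_antisymm _ _ l1 (h3 i q z a)
      · cases (o i).le_antisymm _ _ l2 (h4 i q z b)
    · exact ⟨z, rfl⟩

/-- The step for a composition of two graphs each of which is either small, that is, has a cover
avoiding any given pair, or has initial covers for every large enough set of pairs. -/
lemma exists_initialCover_comp {V W : Type u} [Finite V] [Finite W] {G : SimpleGraph V}
    {H : SimpleGraph W} {K : SimpleGraph (V ⊕ W)} {S : Prop}
    (hl : IsSide G K Sum.inl (Sum.inr : W → V ⊕ W) S)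
    (hr : IsSide H K Sum.inr (Sum.inl : V → V ⊕ W) S) {k s : ℕ} (hs : 0 < s)
    (hG0 : Nat.card V < s → ∀ t, ∃ σ : Fin k × Bool → LinearOrder V, ∀ x, HasCoverAvoiding G t σ x)
    (hH0 : Nat.card W < s → ∀ t, ∃ σ : Fin k × Bool → LinearOrder W, ∀ x, HasCoverAvoiding H t σ x)
    (hG : s ≤ Nat.card V → ∀ P : Finset (Fin k), Nat.card V / s ≤ P.card →
      ∃ σ : Fin k × Bool → LinearOrder V, ∀ x, HasInitialCover G P σ x)
    (hH : s ≤ Nat.card W → ∀ P : Finset (Fin k), Nat.card W / s ≤ P.card →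
      ∃ σ : Fin k × Bool → LinearOrder W, ∀ x, HasInitialCover H P σ x)
    (hK : s ≤ Nat.card (V ⊕ W)) (P : Finset (Fin k)) (hP : Nat.card (V ⊕ W) / s ≤ P.card) :
    ∃ σ : Fin k × Bool → LinearOrder (V ⊕ W), ∀ x, HasInitialCover K P σ x := by
  classical
  have hpos : 0 < P.card := (Nat.div_pos hK hs).trans_le hP
  obtain ⟨t, ht⟩ := Finset.card_pos.1 hpos
  rw [Nat.card_sum] at hP
  rcases lt_or_ge (Nat.card V) s with hV | hV <;> rcases lt_or_ge (Nat.card W) s with hW | hW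
  · obtain ⟨σ, hσ⟩ := hG0 hV t
    obtain ⟨τ, hτ⟩ := hH0 hW t
    obtain ⟨o, h1, h2, -, -⟩ := exists_concat_orders σ τ (fun _ => True)
    refine ⟨o, ?_⟩
    rintro (x | x)
    · exact (hσ x).map hl ht h1 fun i => (h2 i).2
    · exact (hτ x).map hr ht h2 fun i => (h1 i).2
  · obtain ⟨σ, hσ⟩ := hG0 hV t
    obtain ⟨τ, hτ⟩ := hH hW P ((Nat.div_le_div_right (by omega)).trans hP)
    -- Only the large part constrains the directions, so it may use all of `P`.
    obtain ⟨o, h1, h2, h3, h4⟩ := exists_concat_orders σ τ (fun _ => S)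
    refine ⟨o, ?_⟩
    rintro (x | x)
    · exact (hσ x).map hl ht h1 fun i => (h2 i).2
    · exact (hτ x).map hr subset_rfl h2 (fun s t _ a b => h3 _ s b a) (fun s t _ a b => h4 _ s b a)
  · obtain ⟨σ, hσ⟩ := hG hV P ((Nat.div_le_div_right (by omega)).trans hP)
    obtain ⟨τ, hτ⟩ := hH0 hW t
    obtain ⟨o, h1, h2, h3, h4⟩ := exists_concat_orders σ τ (fun _ => ¬ S)
    refine ⟨o, ?_⟩
    rintro (x | x)
    · exact (hσ x).map hl subset_rfl h1 (fun s t _ a b => h4 _ (not_not.2 s) a b)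
        (fun s t _ a b => h3 _ s a b)
    · exact (hτ x).map hr ht h2 fun i => (h1 i).2
  -- Superadditivity of the floor lets `P` split into shares large enough for both parts.
  · have hsum : Nat.card V / s + Nat.card W / s ≤ P.card :=
      Nat.div_add_div_le_add_div.trans hP
    obtain ⟨A, hAP, hA⟩ := Finset.exists_subset_card_eq ((Nat.le_add_right _ _).trans hsum)
    obtain ⟨σ, hσ⟩ := hG hV A hA.ge
    obtain ⟨τ, hτ⟩ := hH hW (P \ A) (by rw [Finset.card_sdiff_of_subset hAP]; omega)
    -- In the pairs of `A` the direction suits the left part, in the others the right part.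
    obtain ⟨o, h1, h2, h3, h4⟩ := exists_concat_orders σ τ (fun i => i.1 ∈ A ↔ ¬ S)
    refine ⟨o, ?_⟩
    rintro (x | x)
    · exact (hσ x).map hl hAP h1 (fun s t ht a b => h4 _ (by simp [ht, s]) a b)
        (fun s t ht a b => h3 _ (by simp [ht, s]) a b)
    · refine (hτ x).map hr Finset.sdiff_subset h2 (fun s t ht a b => h3 _ ?_ b a)
        (fun s t ht a b => h4 _ ?_ b a)
      · simp [(Finset.mem_sdiff.1 ht).2, s]
      · simp [(Finset.mem_sdiff.1 ht).2, s]

lemma IsCograph.finite {V : Type u} {G : SimpleGraph V} (h : IsCograph G) : Finite V := by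
  induction h with
  | single => infer_instance
  | parallel _ _ h1 h2 => infer_instance
  | series _ _ h1 h2 => infer_instance
  | iso _ e h => exact Finite.of_equiv _ e.toEquiv

lemma IsCograph.nonempty {V : Type u} {G : SimpleGraph V} (h : IsCograph G) : Nonempty V := by
  induction h with
  | single => infer_instance
  | parallel _ _ h1 h2 => infer_instance
  | series _ _ h1 h2 => infer_instance
  | iso _ e h => exact h.map e

lemma IsCograph.exists_initialCover {k s : ℕ} (hs : 0 < s)
    (hsmall : ∀ {V : Type u} (G : SimpleGraph V), IsCograph G → Nat.card V < s → ∀ t : Fin k,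
      ∃ σ : Fin k × Bool → LinearOrder V, ∀ x, HasCoverAvoiding G t σ x)
    {V : Type u} {G : SimpleGraph V} (h : IsCograph G) :
    s ≤ Nat.card V → ∀ P : Finset (Fin k), Nat.card V / s ≤ P.card →
      ∃ σ : Fin k × Bool → LinearOrder V, ∀ x, HasInitialCover G P σ x := by
  induction h with
  | @single V _ G =>
    intro hV P hP
    obtain ⟨t, ht⟩ := Finset.card_pos.1 ((Nat.div_pos hV hs).trans_le hP)
    obtain ⟨o⟩ := exists_linearOrder V
    refine ⟨fun _ => o, fun x => ⟨t, ht, fun _ => Set.univ, fun i => isIntervalOf_univ _,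
      fun _ _ _ _ => trivial, ?_⟩⟩
    have : Nonempty (Fin k × Bool) := ⟨(t, true)⟩
    rw [Set.iUnion_const, Set.eq_univ_iff_forall]
    exact fun y => Or.inl (Subsingleton.elim y x)
  | @parallel V W G H hG hH h1 h2 =>
    have := hG.finite
    have := hH.finite
    exact exists_initialCover_comp (isSide_inl_parallel G H) (isSide_inr_parallel G H) hs
      (hsmall G hG) (hsmall H hH) h1 h2
  | @series V W G H hG hH h1 h2 =>
    have := hG.finite
    have := hH.finite
    exact exists_initialCover_comp (isSide_inl_series G H) (isSide_inr_series G H) hs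
      (hsmall G hG) (hsmall H hH) h1 h2
  | @iso V W G H hG e ih =>
    rw [← Nat.card_congr e.toEquiv]
    intro hV P hP
    obtain ⟨σ, hσ⟩ := ih hV P hP
    -- An isomorphism is treated as a parallel composition with an empty second part.
    have hS : IsSide G H e (Empty.elim ∘ ULift.down.{u} : ULift.{u} Empty → W) False :=
      ⟨fun z => by simp, by simp, fun _ x => closedNbhd_iso e x⟩
    refine ⟨fun i => @LinearOrder.lift' W V (σ i) e.symm e.symm.injective, fun x => ?_⟩
    obtain ⟨x, rfl⟩ := e.surjective x
    refine (hσ x).map hS subset_rfl (fun i => ⟨fun a b => ?_, ?_⟩) (by simp) ?_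
    · change (σ i).le (e.symm (e a)) (e.symm (e b)) ↔ _
      simp
    · rw [e.surjective.range_eq]; exact isIntervalOf_univ _
    · exact fun _ _ _ _ b => b.down.elim

/-- A cograph with fewer than `(k + 1)!` vertices has a closed line-model with `2 * k` orders. -/
lemma IsCograph.exists_model (k : ℕ) : ∀ {V : Type u} (G : SimpleGraph V), IsCograph G →
    Nat.card V < (k + 1).factorial → ∃ σ : Fin k × Bool → LinearOrder V, ∀ x,
      ∃ I : Fin k × Bool → Set V, (∀ i, IsIntervalOf (σ i) (I i)) ∧
        closedNbhd G x = ⋃ i, I i := by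
  induction k with
  | zero =>
    intro V G hG hV
    have := hG.finite
    have := hG.nonempty
    have := Nat.card_pos (α := V)
    simp only [zero_add, Nat.factorial_one] at hV
    omega
  | succ k ih =>
    have hsmall : ∀ {V : Type u} (G : SimpleGraph V), IsCograph G →
        Nat.card V < (k + 1).factorial → ∀ t : Fin (k + 1),
        ∃ σ : Fin (k + 1) × Bool → LinearOrder V, ∀ x, HasCoverAvoiding G t σ x := by
      intro V G hG hV t
      obtain ⟨σ, hσ⟩ := ih G hG hV
      obtain ⟨o⟩ := exists_linearOrder V
      refine ⟨fun i => t.insertNth (α := fun _ => LinearOrder V) o (fun j => σ (j, i.2)) i.1,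
        fun x => ?_⟩
      obtain ⟨I, hI, hN⟩ := hσ x
      refine ⟨fun i => t.insertNth (α := fun _ => Set V) ∅ (fun j => I (j, i.2)) i.1, ?_,
        fun b => by simp, ?_⟩
      · rintro ⟨i, b⟩
        induction i using Fin.succAboveCases t with
        | x => simpa using isIntervalOf_empty o
        | p j => simpa using hI (j, b)
      · rw [hN]
        ext z
        simp only [Set.mem_iUnion, Prod.exists, Fin.exists_iff_succAbove t]
        simp
    intro V G hG hV
    rcases lt_or_ge (Nat.card V) (k + 1).factorial with h | h
    · obtain ⟨σ, hσ⟩ := hsmall G hG h 0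
      exact ⟨σ, fun x => let ⟨I, hI, _, hN⟩ := hσ x; ⟨I, hI, hN⟩⟩
    -- The `k + 1` available pairs suffice because `(k + 2)! = (k + 2) * (k + 1)!`.
    · obtain ⟨σ, hσ⟩ := hG.exists_initialCover (Nat.factorial_pos _) hsmall h Finset.univ (by
        rw [Finset.card_univ, Fintype.card_fin, ← Nat.lt_succ_iff,
          Nat.div_lt_iff_lt_mul (Nat.factorial_pos _)]
        simpa [Nat.factorial_succ] using hV)
      exact ⟨σ, fun x => let ⟨_, _, I, hI, _, hN⟩ := hσ x; ⟨I, hI, hN⟩⟩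

lemma IsCograph.lin_le {V : Type u} {G : SimpleGraph V} (hG : IsCograph G) {k : ℕ}
    (hV : Nat.card V < (k + 1).factorial) : lin G ≤ 2 * k := by
  obtain ⟨σ, hσ⟩ := IsCograph.exists_model k G hG hV
  let e : Fin (2 * k) ≃ Fin k × Bool := Fintype.equivOfCardEq (by simp [mul_comm])
  refine Nat.sInf_le ⟨fun i => σ (e i), fun x => ?_⟩
  obtain ⟨I, hI, hN⟩ := hσ x
  exact ⟨fun i => I (e i), fun i => hI _, by rw [hN, e.surjective.iUnion_comp]⟩

/-! ### Upper bound: from factorials to logarithms -/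

/-- One term of the exponential series gives `(k + 1) ^ k / k! ≤ exp (k + 1)`; the error `k + 1 ≤ 3
* (k - 1)` is absorbed using `2 ^ (k - 1) ≤ k!`. -/
lemma log_mul_le_log_factorial {k : ℕ} (hk : 2 ≤ k) :
    k * Real.log (k + 1) ≤ 6 * Real.log k.factorial := by
  have hf : (0 : ℝ) < k.factorial := by positivity
  have h1 : k * Real.log (k + 1) ≤ Real.log k.factorial + (k + 1) := by
    have h := Real.pow_div_factorial_le_exp ((k : ℝ) + 1) (by positivity) k
    have := Real.log_le_log (by positivity) h
    rw [Real.log_exp, Real.log_div (by positivity) (by positivity), Real.log_pow] at this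
    linarith
  have h2 : (k - 1) * Real.log 2 ≤ Real.log k.factorial := by
    have h : ((2 : ℝ) ^ (k - 1)) ≤ k.factorial := by
      obtain ⟨m, rfl⟩ : ∃ m, k = 1 + m := ⟨k - 1, by omega⟩
      have := Nat.factorial_mul_pow_le_factorial (m := 1) (n := m)
      simp only [Nat.factorial_one, one_mul] at this
      rw [Nat.add_sub_cancel_left]
      exact_mod_cast this
    have := Real.log_le_log (by positivity) h
    rwa [Real.log_pow, Nat.cast_sub (by omega), Nat.cast_one] at this
  have h3 := Real.log_two_gt_d9
  have h4 : (2 : ℝ) ≤ k := by exact_mod_cast hk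
  nlinarith

lemma log_log_pos {n : ℕ} (hn : 3 ≤ n) : 0 < Real.log (Real.log 3) ∧
    Real.log (Real.log 3) ≤ Real.log (Real.log n) ∧ 1 < Real.log n := by
  have h3 : 1 < Real.log 3 := by
    rw [Real.lt_log_iff_exp_lt (by norm_num)]
    exact Real.exp_one_lt_d9.trans (by norm_num)
  have hn' : (3 : ℝ) ≤ n := by exact_mod_cast hn
  have h := Real.log_le_log (by norm_num) hn'
  exact ⟨Real.log_pos h3, Real.log_le_log (by linarith) h, h3.trans_le h⟩

lemma IsCograph.lin_le_log {V : Type u} [Fintype V] {G : SimpleGraph V} (hG : IsCograph G)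
    (hV : 3 ≤ Fintype.card V) :
    (lin G : ℝ) ≤
      24 * (Real.log (Fintype.card V : ℝ) / Real.log (Real.log (Fintype.card V : ℝ))) := by
  set n := Fintype.card V with hn
  have hex : ∃ k, n < (k + 1).factorial := ⟨n, (Nat.lt_succ_self n).trans_le (Nat.self_le_factorial _)⟩
  obtain ⟨k, hk, hmin⟩ : ∃ k, n < (k + 1).factorial ∧ k.factorial ≤ n := by
    classical
    refine ⟨Nat.find hex, Nat.find_spec hex, ?_⟩
    rcases h : Nat.find hex with _ | m
    · simp; omega
    · exact not_lt.1 (Nat.find_min hex (m := m) (by omega))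
  have hk2 : 2 ≤ k := by
    by_contra h
    have : (k + 1).factorial ≤ 2 := Nat.factorial_le (n := 2) (by omega)
    omega
  obtain ⟨h0, h1, h2⟩ := log_log_pos hV
  have hlin : (lin G : ℝ) ≤ 2 * k := by
    exact_mod_cast hG.lin_le (by rwa [Nat.card_eq_fintype_card])
  have hk2' : (2 : ℝ) ≤ k := by exact_mod_cast hk2
  have hlogk : 0 < Real.log (k + 1) := Real.log_pos (by linarith)
  have hup : Real.log n ≤ (k + 1) * Real.log (k + 1) := by
    have : (n : ℝ) ≤ ((k : ℝ) + 1) ^ (k + 1) := by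
      exact_mod_cast hk.le.trans (Nat.factorial_le_pow (k + 1))
    have := Real.log_le_log (by positivity) this
    rwa [Real.log_pow, Nat.cast_add, Nat.cast_one] at this
  have hll : Real.log (Real.log n) ≤ 2 * Real.log (k + 1) := by
    have h := Real.log_le_log (by linarith) hup
    rw [Real.log_mul (by positivity) hlogk.ne'] at h
    have := Real.log_le_self hlogk.le
    have := Real.log_le_sub_one_of_pos hlogk
    have h5 : Real.log (Real.log (k + 1)) ≤ Real.log (k + 1) := by linarith
    linarith
  have hlow : Real.log k.factorial ≤ Real.log n :=
    Real.log_le_log (by positivity) (by exact_mod_cast hmin)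
  have := log_mul_le_log_factorial hk2
  have hpos := h0.trans_le h1
  rw [← mul_div_assoc, le_div_iff₀ (by linarith)]
  calc (lin G : ℝ) * Real.log (Real.log n) ≤ 2 * k * (2 * Real.log (k + 1)) := by
        gcongr
    _ ≤ 24 * Real.log n := by linarith

/-! ### Lower bound: induced subgraphs and copies of a graph -/

lemma closedNbhd_preimage {V U : Type u} {G : SimpleGraph V} {K : SimpleGraph U} (f : G ↪g K)
    (x : V) : f ⁻¹' closedNbhd K (f x) = closedNbhd G x := by
  ext y
  simp [closedNbhd, f.map_adj_iff]

lemma IsIntervalOf.preimage {V U : Type u} {o : LinearOrder U} {I : Set U} (hI : IsIntervalOf o I)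
    {f : V → U} (hf : f.Injective) : IsIntervalOf (@LinearOrder.lift' V U o f hf) (f ⁻¹' I) :=
  isIntervalOf_iff.2 fun a ha b hb z h1 h2 => isIntervalOf_iff.1 hI (f a) ha (f b) hb (f z) h1 h2

lemma lin_le_of_embedding {V U : Type u} [Finite U] {G : SimpleGraph V} {K : SimpleGraph U}
    (f : G ↪g K) : lin G ≤ lin K := by
  obtain ⟨σ, hσ⟩ := exists_isClosedLineModel_lin K
  refine Nat.sInf_le ⟨fun i => @LinearOrder.lift' V U (σ i) f f.injective, fun x => ?_⟩
  obtain ⟨I, hI, hN⟩ := hσ (f x)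
  exact ⟨fun i => f ⁻¹' I i, fun i => (hI i).preimage f.injective, by
    rw [← closedNbhd_preimage f, hN, Set.preimage_iUnion]⟩

/-- The disjoint union of `d` copies of `G`. -/
def copies (d : ℕ) {V : Type u} (G : SimpleGraph V) : SimpleGraph (Fin d × V) where
  Adj a b := a.1 = b.1 ∧ G.Adj a.2 b.2
  symm := ⟨fun _ _ h => ⟨h.1.symm, h.2.symm⟩⟩
  loopless := ⟨fun a h => G.loopless.irrefl a.2 h.2⟩

/-- Splitting off the first copy of `G`. -/
noncomputable def copiesSucc (d : ℕ) {V : Type u} (G : SimpleGraph V) :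
    (G ⊕g copies d G) ≃g copies (d + 1) G where
  toEquiv := Equiv.ofBijective
    (Sum.elim (fun v => ((0 : Fin (d + 1)), v)) (fun a => (a.1.succ, a.2))) (by
      constructor
      · rintro (a | ⟨i, a⟩) (b | ⟨j, b⟩) h <;> simp_all [Fin.ext_iff]
      · rintro ⟨i, a⟩
        induction i using Fin.cases with
        | zero => exact ⟨Sum.inl a, rfl⟩
        | succ i => exact ⟨Sum.inr (i, a), rfl⟩)
  map_rel_iff' := by
    rintro (a | ⟨i, a⟩) (b | ⟨j, b⟩)
    · change (0 : Fin (d + 1)) = 0 ∧ G.Adj a b ↔ G.Adj a b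
      simp
    · change (0 : Fin (d + 1)) = j.succ ∧ G.Adj a b ↔ _
      simp [(Fin.succ_ne_zero j).symm]
    · change i.succ = (0 : Fin (d + 1)) ∧ G.Adj a b ↔ _
      simp
    · change i.succ = j.succ ∧ G.Adj a b ↔ i = j ∧ G.Adj a b
      simp

/-- A single copy of `G` is `G`. -/
def copiesOne {V : Type u} (G : SimpleGraph V) : G ≃g copies 1 G where
  toEquiv := (Equiv.uniqueProd V (Fin 1)).symm
  map_rel_iff' := by simp [copies]

lemma IsCograph.copies {V : Type u} {G : SimpleGraph V} (hG : IsCograph G) (d : ℕ) :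
    IsCograph (copies (d + 1) G) := by
  induction d with
  | zero => exact hG.iso (copiesOne G)
  | succ d ih => exact (hG.parallel ih).iso (copiesSucc (d + 1) G)

/-! ### Lower bound: forcing many nonempty intervals -/

/-- In any family of at most `(d - 1) / 2` linear orders, some closed neighbourhood of `G` can be
covered by intervals only if at least `j` of these are nonempty. -/
def NeedsIntervals (j d : ℕ) {V : Type u} (G : SimpleGraph V) : Prop :=
  ∀ p : ℕ, 2 * p + 1 ≤ d → ∀ σ : Fin p → LinearOrder V, ∃ x, ∀ I : Fin p → Set V,
    (∀ i, IsIntervalOf (σ i) (I i)) → closedNbhd G x = ⋃ i, I i →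
      j ≤ {i | (I i).Nonempty}.ncard

lemma needsIntervals_one (d : ℕ) {V : Type u} [Nonempty V] (G : SimpleGraph V) :
    NeedsIntervals 1 d G := by
  intro p _ σ
  obtain ⟨x⟩ := ‹Nonempty V›
  refine ⟨x, fun I _ hN => ?_⟩
  have hx : x ∈ ⋃ i, I i := hN ▸ Set.mem_insert _ _
  obtain ⟨i, hi⟩ := Set.mem_iUnion.1 hx
  exact Nat.one_le_iff_ne_zero.2 (Set.ncard_ne_zero_of_mem (a := i) ⟨x, hi⟩ (Set.toFinite _))

/-- Pigeonhole: a copy violating the claim has, in some order and on some side of `y`, a vertex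
closer to `y` than all other copies. Each of the `2 * p` pairs of an order and a side admits only
one such copy. -/
lemma exists_copy_not_nearest {V W : Type u} {p d : ℕ} (hd : 2 * p + 1 ≤ d)
    (σ : Fin p → LinearOrder W) (y : W) (f : Fin d → V → W) :
    ∃ c : Fin d, ∀ i : Fin p, ∀ v,
      ((σ i).le y (f c v) → ∃ c' ≠ c, ∃ v', (σ i).le y (f c' v') ∧ (σ i).le (f c' v') (f c v)) ∧
      ((σ i).le (f c v) y → ∃ c' ≠ c, ∃ v', (σ i).le (f c v) (f c' v') ∧ (σ i).le (f c' v') y) := by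
  by_contra! H
  choose g v hgv using H
  have hsplit : ∀ c, ∃ b : Bool,
      (b = true → (σ (g c)).le y (f c (v c)) ∧ ∀ c' ≠ c, ∀ v', (σ (g c)).le y (f c' v') →
        (σ (g c)).lt (f c (v c)) (f c' v')) ∧
      (b = false → (σ (g c)).le (f c (v c)) y ∧ ∀ c' ≠ c, ∀ v', (σ (g c)).le (f c (v c)) (f c' v') →
        (σ (g c)).lt y (f c' v')) := by
    intro c
    let _ := σ (g c)
    by_cases h : (σ (g c)).le y (f c (v c)) ∧ ∀ c' ≠ c, ∀ v', (σ (g c)).le y (f c' v') →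
        (σ (g c)).lt (f c (v c)) (f c' v')
    · exact ⟨true, fun _ => h, by simp⟩
    · refine ⟨false, by simp, fun _ => hgv c fun h1 => ?_⟩
      by_contra! h2
      exact h ⟨h1, fun c' hc v' hv => h2 c' hc v' hv⟩
  choose b hb1 hb2 using hsplit
  have hinj : Function.Injective fun c => (g c, b c) := by
    intro c c' h
    obtain ⟨h1, h2⟩ := Prod.mk.inj h
    by_contra hc
    have key1 := hb1 c
    have key2 := hb2 c
    have key1' := hb1 c'
    have key2' := hb2 c'
    rw [← h1, ← h2] at key1' key2'
    let _ := σ (g c)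
    cases hb : b c with
    | true =>
      obtain ⟨l, r⟩ := key1 hb
      obtain ⟨l', r'⟩ := key1' hb
      exact lt_asymm (r c' (Ne.symm hc) _ l') (r' c hc _ l)
    | false =>
      obtain ⟨l, r⟩ := key2 hb
      obtain ⟨l', r'⟩ := key2' hb
      rcases le_total (f c (v c)) (f c' (v c')) with h | h
      · exact not_lt_of_ge l' (r c' (Ne.symm hc) _ h)
      · exact not_lt_of_ge l (r' c hc _ h)
  have := Fintype.card_le_of_injective _ hinj
  simp at this
  omega

lemma NeedsIntervals.series_copies {j d : ℕ} {V T : Type u} [Unique T] {G : SimpleGraph V}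
    (hG : NeedsIntervals j d G) (E : SimpleGraph T) :
    NeedsIntervals (j + 1) d (seriesComp E (copies d G)) := by
  intro p hp σ
  set y : T ⊕ (Fin d × V) := Sum.inl default
  obtain ⟨c, hc⟩ := exists_copy_not_nearest hp σ y fun c v => Sum.inr (c, v)
  obtain ⟨f, hf⟩ : ∃ f : G ↪g seriesComp E (copies d G), ∀ v, f v = Sum.inr (c, v) :=
    ⟨{  toFun := fun v => Sum.inr (c, v)
        inj' := fun a b h => by simpa using h
        map_rel_iff' := fun {a b} => by
          change (seriesComp E (copies d G)).Adj (Sum.inr (c, a)) (Sum.inr (c, b)) ↔ _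
          simp [seriesComp, copies] }, fun _ => rfl⟩
  obtain ⟨v, hv⟩ := hG p hp fun i => @LinearOrder.lift' _ _ (σ i) f f.injective
  refine ⟨f v, fun I hI hN => ?_⟩
  have hcard := hv (fun i => f ⁻¹' I i) (fun i => (hI i).preimage f.injective) (by
    rw [← closedNbhd_preimage f, hN, Set.preimage_iUnion])
  have hy : y ∈ ⋃ i, I i := by
    rw [← hN, hf]
    simp [closedNbhd, seriesComp, y]
  obtain ⟨i, hi⟩ := Set.mem_iUnion.1 hy
  -- The interval through `y` avoids the other copies, which are not adjacent to copy `c`; by the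
  -- choice of `c` it then misses copy `c` too and is lost on restriction.
  have hout : ∀ c' ≠ c, ∀ w, Sum.inr (c', w) ∉ I i := by
    intro c' hne w hw
    have : Sum.inr (c', w) ∈ ⋃ i, I i := Set.mem_iUnion.2 ⟨i, hw⟩
    rw [← hN, hf] at this
    simp [closedNbhd, seriesComp, copies, hne, hne.symm] at this
  have hint := isIntervalOf_iff.1 (hI i)
  have hempty : ¬ (f ⁻¹' I i).Nonempty := by
    rintro ⟨w, hw⟩
    rw [Set.mem_preimage, hf] at hw
    rcases (σ i).le_total y (Sum.inr (c, w)) with h | h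
    · obtain ⟨c', hne, w', h1, h2⟩ := (hc i w).1 h
      exact hout c' hne w' (hint _ hi _ hw _ h1 h2)
    · obtain ⟨c', hne, w', h1, h2⟩ := (hc i w).2 h
      exact hout c' hne w' (hint _ hw _ hi _ h1 h2)
  refine hcard.trans_lt (Set.ncard_lt_ncard (Set.ssubset_iff_of_subset ?_ |>.2 ⟨i, ⟨y, hi⟩, hempty⟩)
    (Set.toFinite _))
  rintro k ⟨w, hw⟩
  exact ⟨f w, hw⟩

lemma exists_needsIntervals (d j : ℕ) : ∃ (V : Type) (G : SimpleGraph V), IsCograph G ∧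
    Nat.card V ≤ (d + 2) ^ j ∧ NeedsIntervals (j + 1) (d + 1) G := by
  induction j with
  | zero => exact ⟨Unit, ⊥, .single _, by simp, needsIntervals_one _ _⟩
  | succ j ih =>
    obtain ⟨V, G, hG, hV, hN⟩ := ih
    have := hG.finite
    refine ⟨Unit ⊕ (Fin (d + 1) × V), seriesComp ⊥ (copies (d + 1) G),
      (IsCograph.single _).series (hG.copies d), ?_, hN.series_copies _⟩
    rw [Nat.card_sum, Nat.card_prod, Nat.card_unique, Nat.card_fin, pow_succ]
    have := Nat.one_le_pow j (d + 2) (by omega)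
    nlinarith

lemma NeedsIntervals.le_lin {h : ℕ} {V : Type u} [Finite V] {G : SimpleGraph V}
    (hG : NeedsIntervals (h + 1) (2 * h + 1) G) : h + 1 ≤ lin G := by
  by_contra! hlt
  obtain ⟨σ, hσ⟩ := exists_isClosedLineModel_lin G
  obtain ⟨x, hx⟩ := hG (lin G) (by omega) σ
  obtain ⟨I, hI, hN⟩ := hσ x
  have h1 := hx I hI hN
  have h2 := Set.ncard_le_card {i | (I i).Nonempty}
  rw [Nat.card_fin] at h2
  omega

/-- A cograph extends to a cograph on any larger number of vertices. -/
lemma IsCograph.exists_embedding_fin {V : Type} {G : SimpleGraph V} (hG : IsCograph G) {n : ℕ}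
    (hn : Nat.card V ≤ n) : ∃ K : SimpleGraph (Fin n), IsCograph K ∧ Nonempty (G ↪g K) := by
  have := hG.finite
  have toFin : ∀ {W : Type} {H : SimpleGraph W}, IsCograph H → Nat.card W = n → (G ↪g H) →
      ∃ K : SimpleGraph (Fin n), IsCograph K ∧ Nonempty (G ↪g K) := by
    intro W H hH hW f
    have := hH.finite
    have e : W ≃ Fin n := hW ▸ Finite.equivFin W
    exact ⟨_, hH.iso (SimpleGraph.Iso.map e H), ⟨(SimpleGraph.Iso.map e H).toEmbedding.comp f⟩⟩
  rcases hn.eq_or_lt with h | h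
  · exact toFin hG h SimpleGraph.Embedding.refl
  -- The missing `m + 1` vertices are added as isolated ones.
  · obtain ⟨m, rfl⟩ := Nat.exists_eq_add_of_lt h
    exact toFin (hG.parallel ((IsCograph.single (⊥ : SimpleGraph Unit)).copies m))
      (by simp [Nat.card_sum, add_assoc]) SimpleGraph.Embedding.sumInl

lemma exists_cograph_le_lin {h n : ℕ} (hn : (2 * h + 2) ^ h ≤ n) :
    ∃ K : SimpleGraph (Fin n), IsCograph K ∧ h + 1 ≤ lin K := by
  obtain ⟨V, G, hG, hV, hN⟩ := exists_needsIntervals (2 * h) h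
  have := hG.finite
  obtain ⟨K, hK, ⟨f⟩⟩ := hG.exists_embedding_fin (hV.trans hn)
  exact ⟨K, hK, hN.le_lin.trans (lin_le_of_embedding f)⟩

/-! ### Lower bound: logarithmic form, and the theorem -/

lemma exists_cograph_log_le_lin {n : ℕ} (hn : 3 ≤ n) :
    ∃ K : SimpleGraph (Fin n), IsCograph K ∧
      Real.log n / Real.log (Real.log n) ≤ (3 + 4 / Real.log (Real.log 3)) * (lin K : ℝ) := by
  obtain ⟨h, hlow, hup⟩ : ∃ h, (2 * h + 2) ^ h ≤ n ∧ n < (2 * h + 4) ^ (h + 1) := by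
    classical
    have hex : ∃ h, n < (2 * h + 4) ^ (h + 1) :=
      ⟨n, (by omega : n < 2 * n + 4).trans_le (Nat.le_self_pow (by omega) _)⟩
    refine ⟨Nat.find hex, ?_, Nat.find_spec hex⟩
    rcases hf : Nat.find hex with _ | m
    · simp; omega
    · exact not_lt.1 (Nat.find_min hex (m := m) (by omega))
  obtain ⟨K, hK, hlin⟩ := exists_cograph_le_lin hlow
  refine ⟨K, hK, ?_⟩
  obtain ⟨h0, h1, h2⟩ := log_log_pos hn
  have hlin' : (h : ℝ) + 1 ≤ lin K := by exact_mod_cast hlin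
  refine le_trans ?_ (mul_le_mul_of_nonneg_left hlin' (by positivity))
  have hL : Real.log n ≤ (h + 1) * Real.log (2 * h + 4) := by
    have : (n : ℝ) ≤ (2 * (h : ℝ) + 4) ^ (h + 1) := by exact_mod_cast hup.le
    have := Real.log_le_log (by positivity) this
    rwa [Real.log_pow, Nat.cast_add, Nat.cast_one] at this
  rw [add_mul]
  -- The two summands of the constant serve the two cases. In the second, `log n` itself is at most
  -- `4 * (h + 1)`, and the denominator is at least `log (log 3)`.
  rcases le_or_gt (Real.log (2 * h + 4)) (3 * Real.log (Real.log n)) with hc | hc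
  · have : Real.log n / Real.log (Real.log n) ≤ 3 * (h + 1) := by
      rw [div_le_iff₀ (by linarith)]
      calc Real.log n ≤ (h + 1) * Real.log (2 * h + 4) := hL
        _ ≤ (h + 1) * (3 * Real.log (Real.log n)) := by gcongr
        _ = _ := by ring
    have : 0 ≤ 4 / Real.log (Real.log 3) * ((h : ℝ) + 1) := by positivity
    linarith
  · have h3 : Real.log n ^ 3 < 2 * h + 4 := by
      rw [← Real.log_lt_log_iff (by positivity) (by positivity), Real.log_pow]
      exact_mod_cast hc
    have h4 : Real.log n ≤ 4 * (h + 1) := by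
      have := le_self_pow₀ h2.le (n := 3) (by norm_num)
      have : (0 : ℝ) ≤ h := by positivity
      linarith
    have : Real.log n / Real.log (Real.log n) ≤ 4 / Real.log (Real.log 3) * (h + 1) := by
      rw [div_mul_eq_mul_div]
      exact div_le_div₀ (by positivity) h4 h0 h1
    have : (0 : ℝ) ≤ 3 * (h + 1) := by positivity
    linarith

theorem theorem1 :
    (∃ C : ℝ, 0 < C ∧ ∀ (V : Type u) [Fintype V] (G : SimpleGraph V), IsCograph G →
      3 ≤ Fintype.card V →
        (lin G : ℝ) ≤
          C * (Real.log (Fintype.card V : ℝ) / Real.log (Real.log (Fintype.card V : ℝ)))) ∧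
    (∃ c : ℝ, 0 < c ∧ ∀ n : ℕ, 3 ≤ n → ∃ G : SimpleGraph (Fin n), IsCograph G ∧
        c * (Real.log (n : ℝ) / Real.log (Real.log (n : ℝ))) ≤ (lin G : ℝ)) := by
  refine ⟨⟨24, by norm_num, fun V _ G hG hV => hG.lin_le_log hV⟩, ?_⟩
  have h0 := (log_log_pos (n := 3) le_rfl).1
  have hA : 0 < 3 + 4 / Real.log (Real.log 3) := by positivity
  refine ⟨(3 + 4 / Real.log (Real.log 3))⁻¹, inv_pos.2 hA, fun n hn => ?_⟩
  obtain ⟨K, hK, h⟩ := exists_cograph_log_le_lin hn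
  exact ⟨K, hK, (inv_mul_le_iff₀ hA).2 h⟩
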